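/- **Notation.** For a $g$-tuple $z=(z_1,\dots,z_g)$ of complex $d\times d$ matrices let $\mathcal O_z=\mathrm{Span}_{\mathbb C}\{1_d,z_k,z_k^*: 1\le k\le g\}$. The *matrix range* of $z$ is the sequence $W(z)=(W^n(z))_{n\ge1}$, where $W^n(z)\subseteq M_n(\mathbb C)^g$ is the set of all $(\psi(z_1),\dots,\psi(z_g))$ with $\psi:\mathcal O_z\to M_n(\mathbb C)$ a unital completely positive linear map. For a sequence $K=(K_n)_{n\ge1}$ of sets $K_n\subseteq M_n(\mathbb C)^g$, a *matrix convex combination* of elements $a_j\in K_{n_j}$, $1\le j\le m$, is a tuple $\sum_{j=1}^m\gamma_j^*a_j\gamma_j\in M_n(\mathbb C)^g$, where $n\geq 1$ and the linear maps $\gamma_j:\mathbb C^n\to\mathbb C^{n_j}$ satisfy $\sum_j\gamma_j^*\gamma_j=1_n$ (products with a tuple are taken entrywise); $K$ is *matrix convex* if it contains all matrix convex combinations of its elements. Write $a\simeq_{\mathrm u}b$ if $b=w^*aw$ for a unitary $w$. Let $K$ be matrix convex and $b\in K_n$. * $b$ is a *matrix extreme point* of $K$ if, whenever $b=\sum_{j=1}^m\gamma_j^*a_j\gamma_j$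 is a matrix convex combination of elements $a_j\in K_{n_j}$ with every $\gamma_j$ surjective, then for each $j$ one has $n_j=n$ and $a_j\simeq_{\mathrm u}b$. * $b$ is an *absolute extreme point* of $K$ if, whenever $b=\sum_{j=1}^m\gamma_j^*a_j\gamma_j$ is a matrix convex combination of elements $a_j\in K_{n_j}$ with every $\gamma_j$ nonzero, then for each $j$ either $n_j=n$ and $a_j\simeq_{\mathrm u}b$, or $n_j>n$ and $a_j\simeq_{\mathrm u}b\oplus c_j$ for some tuple $c_j$ of matrices. **Theorem.** Let $p\ge2$ be an integer and let $\zeta\in\mathbb C$ be a primitive $p$-th root of unity. Let $\mathfrak u=\mathrm{diag}(1,\zeta,\dots,\zeta^{p-1})$ and let $\mathfrak v$ be the $p\times p$ cyclic shift matrix, which maps the standard basis vectors $e_0,\dots,e_{p-1}$ by $\mathfrak v e_j=e_{j+1 \bmod p}$. Put $$\omega_a=\mathfrak u,\qquad \omega_b=\zeta^{\frac{p-1}{2}}\,\mathfrak u\mathfrak v,\qquad \omega_c=\mathfrak v,$$ where $\zeta^{\frac{p-1}{2}}$ means $\eta^{p-1}$ for a square root $\eta$ of $\zeta$ (for odd $p$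 it does not depend on the choice of $\eta$; for even $p$ either choice is allowed). Then the matrix range $W(\mathfrak W)$ of the triple $\mathfrak W=(\omega_a,\omega_b,\omega_c)$ is matrix convex, and $\mathfrak W\in W^p(\mathfrak W)$ is both a matrix extreme point and an absolute extreme point of $W(\mathfrak W)$. -/

import Mathlib

open Matrix
open scoped ComplexOrder

noncomputable section

namespace WeylBrauer

/-! ### The Weyl matrices -/

/-- The Weyl unitary `diag (1, ζ, ζ ^ 2, …, ζ ^ (p - 1))`. -/
def weylU (p : ℕ) (ζ : ℂ) : Matrix (Fin p) (Fin p) ℂ :=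
  Matrix.diagonal fun i => ζ ^ (i : ℕ)

/-- The cyclic shift: its `(i, j)` entry is `1` if `i = j + 1` modulo `p`, and `0` otherwise. -/
def weylV (p : ℕ) : Matrix (Fin p) (Fin p) ℂ :=
  Matrix.of fun i j => if (i : ℕ) = ((j : ℕ) + 1) % p then 1 else 0

/-- The triple `(ω_a, ω_b, ω_c) = (𝔲, ζ ^ ((p - 1) / 2) 𝔲 𝔳, 𝔳)`. Here `η` stands for a square root
of `ζ`, and `ζ ^ ((p - 1) / 2)` is `η ^ (p - 1)`; if `p` is odd, this is the integral power of `ζ`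
and does not depend on the choice of `η`. -/
def weylTriple (p : ℕ) (ζ η : ℂ) : Fin 3 → Matrix (Fin p) (Fin p) ℂ :=
  ![weylU p ζ, η ^ (p - 1) • (weylU p ζ * weylV p), weylV p]

/-! ### Operator systems, ucp maps, and the matrix range -/

/-- The operator system of a tuple `z` of matrices: the span of `1`, all `z k` and all `(z k)ᴴ`. -/
def operatorSystem {g d : ℕ} (z : Fin g → Matrix (Fin d) (Fin d) ℂ) :
    Submodule ℂ (Matrix (Fin d) (Fin d) ℂ) :=
  Submodule.span ℂ ({1} ∪ (Set.range z ∪ Set.range fun k => (z k)ᴴ))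

theorem one_mem_operatorSystem {g d : ℕ} (z : Fin g → Matrix (Fin d) (Fin d) ℂ) :
    (1 : Matrix (Fin d) (Fin d) ℂ) ∈ operatorSystem z :=
  Submodule.subset_span (Or.inl rfl)

theorem mem_operatorSystem {g d : ℕ} (z : Fin g → Matrix (Fin d) (Fin d) ℂ) (k : Fin g) :
    z k ∈ operatorSystem z :=
  Submodule.subset_span (Or.inr (Or.inl ⟨k, rfl⟩))

/-- Unital completely positive linear maps from the operator system of `z` into the `n × n`
matrices: `ψ` maps the identity to the identity, and for each `k` the entrywise application of `ψ`
maps every `k × k` matrix over the operator system that is positive semidefinite (as a complex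
matrix of size `k d`) to a positive semidefinite matrix (of size `k n`). -/
structure IsUCP {g d n : ℕ} (z : Fin g → Matrix (Fin d) (Fin d) ℂ)
    (ψ : operatorSystem z →ₗ[ℂ] Matrix (Fin n) (Fin n) ℂ) : Prop where
  map_one : ψ ⟨1, one_mem_operatorSystem z⟩ = 1
  map_posSemidef : ∀ (k : ℕ) (X : Matrix (Fin k) (Fin k) (operatorSystem z)),
    (Matrix.comp (Fin k) (Fin k) (Fin d) (Fin d) ℂ
      (X.map fun x => (x : Matrix (Fin d) (Fin d) ℂ))).PosSemidef →
    (Matrix.comp (Fin k) (Fin k) (Fin n) (Fin n) ℂ (X.map ψ)).PosSemidef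

/-- The matrix range of `z`: its `n`-th level consists of all `(ψ (z 1), …, ψ (z g))`, where `ψ` is
a ucp map from the operator system of `z` into the `n × n` matrices. -/
def matrixRange {g d : ℕ} (z : Fin g → Matrix (Fin d) (Fin d) ℂ) (n : ℕ) :
    Set (Fin g → Matrix (Fin n) (Fin n) ℂ) :=
  {a | ∃ ψ : operatorSystem z →ₗ[ℂ] Matrix (Fin n) (Fin n) ℂ,
    IsUCP z ψ ∧ ∀ k, a k = ψ ⟨z k, mem_operatorSystem z k⟩}

/-! ### Matrix convexity and extreme points

A graded set is a family `K` whose member `K n` is a set of `g`-tuples of `n × n` matrices; only the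
levels `n ≥ 1` are considered. -/

/-- `b = ∑ j, (γ j)ᴴ (a j) (γ j)` is a matrix convex combination, with matrix convex coefficients
`γ j : ℂ ^ n → ℂ ^ (N j)`, of elements `a j` of `K (N j)`. -/
structure IsMatrixConvexCombination {g : ℕ} (K : ∀ n : ℕ, Set (Fin g → Matrix (Fin n) (Fin n) ℂ))
    {n m : ℕ} (N : Fin m → ℕ) (a : ∀ j, Fin g → Matrix (Fin (N j)) (Fin (N j)) ℂ)
    (γ : ∀ j, Matrix (Fin (N j)) (Fin n) ℂ) (b : Fin g → Matrix (Fin n) (Fin n) ℂ) : Prop where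
  pos : ∀ j, 0 < N j
  mem : ∀ j, a j ∈ K (N j)
  sum_coeff : ∑ j, (γ j)ᴴ * γ j = 1
  eq_sum : ∀ k, b k = ∑ j, (γ j)ᴴ * a j k * γ j

/-- `K` is matrix convex if it contains all matrix convex combinations of its elements. -/
def IsMatrixConvex {g : ℕ} (K : ∀ n : ℕ, Set (Fin g → Matrix (Fin n) (Fin n) ℂ)) : Prop :=
  ∀ (n m : ℕ) (N : Fin m → ℕ) (a : ∀ j, Fin g → Matrix (Fin (N j)) (Fin (N j)) ℂ)
    (γ : ∀ j, Matrix (Fin (N j)) (Fin n) ℂ) (b : Fin g → Matrix (Fin n) (Fin n) ℂ),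
    0 < n → IsMatrixConvexCombination K N a γ b → b ∈ K n

/-- Unitary equivalence of tuples: `b = Uᴴ a U` for a unitary `U`. The two index types may differ
(they then have the same number of elements), so that a tuple can be compared with a direct sum. -/
def UnitarilyEquivalent {g : ℕ} {ι κ : Type} [Fintype ι] [DecidableEq ι] [Fintype κ]
    [DecidableEq κ] (a : Fin g → Matrix ι ι ℂ) (b : Fin g → Matrix κ κ ℂ) : Prop :=
  ∃ U : Matrix ι κ ℂ, Uᴴ * U = 1 ∧ U * Uᴴ = 1 ∧ ∀ k, b k = Uᴴ * a k * U

/-- The direct sum of two tuples of matrices. -/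
def tupleSum {g n l : ℕ} (b : Fin g → Matrix (Fin n) (Fin n) ℂ)
    (c : Fin g → Matrix (Fin l) (Fin l) ℂ) : Fin g → Matrix (Fin n ⊕ Fin l) (Fin n ⊕ Fin l) ℂ :=
  fun k => Matrix.fromBlocks (b k) 0 0 (c k)

/-- `b` is a matrix extreme point of the matrix convex set `K`. -/
structure IsMatrixExtremePoint {g : ℕ} (K : ∀ n : ℕ, Set (Fin g → Matrix (Fin n) (Fin n) ℂ))
    {n : ℕ} (b : Fin g → Matrix (Fin n) (Fin n) ℂ) : Prop where
  convex : IsMatrixConvex K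
  mem : b ∈ K n
  extreme : ∀ (m : ℕ) (N : Fin m → ℕ) (a : ∀ j, Fin g → Matrix (Fin (N j)) (Fin (N j)) ℂ)
    (γ : ∀ j, Matrix (Fin (N j)) (Fin n) ℂ),
    IsMatrixConvexCombination K N a γ b →
    (∀ j, Function.Surjective (γ j).mulVec) →
    ∀ j, N j = n ∧ UnitarilyEquivalent (a j) b

/-- `b` is an absolute extreme point of the matrix convex set `K`. -/
structure IsAbsoluteExtremePoint {g : ℕ} (K : ∀ n : ℕ, Set (Fin g → Matrix (Fin n) (Fin n) ℂ))
    {n : ℕ} (b : Fin g → Matrix (Fin n) (Fin n) ℂ) : Prop where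
  convex : IsMatrixConvex K
  mem : b ∈ K n
  extreme : ∀ (m : ℕ) (N : Fin m → ℕ) (a : ∀ j, Fin g → Matrix (Fin (N j)) (Fin (N j)) ℂ)
    (γ : ∀ j, Matrix (Fin (N j)) (Fin n) ℂ),
    IsMatrixConvexCombination K N a γ b →
    (∀ j, γ j ≠ 0) →
    ∀ j, (N j = n ∧ UnitarilyEquivalent (a j) b) ∨
      (n < N j ∧ ∃ (l : ℕ) (c : Fin g → Matrix (Fin l) (Fin l) ℂ),
        UnitarilyEquivalent (a j) (tupleSum b c))

end WeylBrauer

end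

namespace WeylBrauer

/-! ### The matrix range is matrix convex -/

/-! Only two properties of the triple matter: its entries are unitary, and only scalars commute with
all of them. A ucp map sends a unitary `u` to a contraction, as positivity of `[1, u; uᴴ, 1]` shows.
If contractions `a j` combine to a unitary `b` with coefficients `γ j`, equality is forced in every
term: `a j * γ j = γ j * b` (`intertwines_of_sum_eq_unitary`). The same holds for adjoints, so `(γ
j)ᴴ * γ j` commutes with the tuple and is a scalar, and a nonzero `γ j` is a multiple of an
intertwining isometry (`exists_isometry_intertwines`). Its range reduces `a j`, which is therefore
equivalent to the tuple, or to a direct sum containing it. -/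

theorem comp_map_sum_conj {S : Type*} {k n m : ℕ} {N : Fin m → ℕ}
    (γ : ∀ j, Matrix (Fin (N j)) (Fin n) ℂ) (φ : ∀ j, S → Matrix (Fin (N j)) (Fin (N j)) ℂ)
    (X : Matrix (Fin k) (Fin k) S) :
    Matrix.comp (Fin k) (Fin k) (Fin n) (Fin n) ℂ
        (X.map fun x => ∑ j, (γ j)ᴴ * φ j x * γ j) =
      ∑ j, (Matrix.kroneckerMap (· * ·) (1 : Matrix (Fin k) (Fin k) ℂ) (γ j))ᴴ *
        Matrix.comp (Fin k) (Fin k) (Fin (N j)) (Fin (N j)) ℂ (X.map (φ j)) *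
        Matrix.kroneckerMap (· * ·) (1 : Matrix (Fin k) (Fin k) ℂ) (γ j) := by
  ext ⟨i, r⟩ ⟨i', r'⟩
  simp only [Matrix.comp_apply, Matrix.map_apply, Matrix.sum_apply]
  refine Finset.sum_congr rfl fun j _ => ?_
  simp [Matrix.mul_apply, Fintype.sum_prod_type, Matrix.one_apply, Finset.sum_mul,
    apply_ite (star : ℂ → ℂ), ite_mul]

theorem isMatrixConvex_matrixRange {g d : ℕ} (z : Fin g → Matrix (Fin d) (Fin d) ℂ) :
    IsMatrixConvex (matrixRange z) := by
  intro n m N a γ b _ h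
  choose ψ hψ hψa using h.mem
  let φ : operatorSystem z →ₗ[ℂ] Matrix (Fin n) (Fin n) ℂ :=
    { toFun := fun x => ∑ j, (γ j)ᴴ * ψ j x * γ j
      map_add' := fun x y => by simp [Matrix.mul_add, Matrix.add_mul, Finset.sum_add_distrib]
      map_smul' := fun c x => by simp [Finset.smul_sum] }
  refine ⟨φ, ⟨?_, fun k X hX => ?_⟩, fun k => ?_⟩
  · change ∑ j, (γ j)ᴴ * ψ j _ * γ j = 1
    simp only [fun j => (hψ j).map_one, Matrix.mul_one, h.sum_coeff]
  · have := comp_map_sum_conj γ (fun j => ψ j) X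
    change (Matrix.comp _ _ _ _ ℂ (X.map fun x => ∑ j, (γ j)ᴴ * ψ j x * γ j)).PosSemidef
    rw [this]
    exact Matrix.posSemidef_sum _ fun j _ =>
      ((hψ j).map_posSemidef k X hX).conjTranspose_mul_mul_same _
  · rw [h.eq_sum]
    exact Finset.sum_congr rfl fun j _ => by rw [hψa]

theorem mem_matrixRange_self {g d : ℕ} (z : Fin g → Matrix (Fin d) (Fin d) ℂ) :
    z ∈ matrixRange z d :=
  ⟨(operatorSystem z).subtype, ⟨rfl, fun _ _ h => h⟩, fun _ => rfl⟩

/-! ### Images of unitaries under ucp maps -/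

theorem conjTranspose_mem_operatorSystem {g d : ℕ} (z : Fin g → Matrix (Fin d) (Fin d) ℂ)
    (k : Fin g) : (z k)ᴴ ∈ operatorSystem z :=
  Submodule.subset_span (Or.inr (Or.inr ⟨k, rfl⟩))

/-- A ucp map sends the positive block matrix `[1, u; uᴴ, 1]` of a unitary `u` to a positive block
matrix. -/
theorem IsUCP.posSemidef_fromBlocks {g d n : ℕ} {z : Fin g → Matrix (Fin d) (Fin d) ℂ}
    {ψ : operatorSystem z →ₗ[ℂ] Matrix (Fin n) (Fin n) ℂ} (hψ : IsUCP z ψ)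
    {u : Matrix (Fin d) (Fin d) ℂ} (hu : u ∈ operatorSystem z) (hu' : uᴴ ∈ operatorSystem z)
    (h : uᴴ * u = 1) :
    (Matrix.fromBlocks 1 (ψ ⟨u, hu⟩) (ψ ⟨uᴴ, hu'⟩) 1).PosSemidef := by
  let X : Matrix (Fin 2) (Fin 2) (operatorSystem z) :=
    !![⟨1, one_mem_operatorSystem z⟩, ⟨u, hu⟩; ⟨uᴴ, hu'⟩, ⟨1, one_mem_operatorSystem z⟩]
  have hX : (Matrix.comp (Fin 2) (Fin 2) (Fin d) (Fin d) ℂ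
      (X.map fun x => (x : Matrix (Fin d) (Fin d) ℂ))).PosSemidef := by
    -- With the block row `B = [1, u]`, the matrix is `Bᴴ * B`, because `uᴴ * u = 1`.
    let B : Matrix (Fin d) (Fin 2 × Fin d) ℂ :=
      Matrix.of fun i q => (![1, u] : Fin 2 → Matrix (Fin d) (Fin d) ℂ) q.1 i q.2
    convert Matrix.posSemidef_conjTranspose_mul_self B
    ext ⟨i, r⟩ ⟨i', r'⟩
    have h1 := congrFun (congrFun h r) r'
    rw [Matrix.mul_apply] at h1
    fin_cases i <;> fin_cases i' <;>
      simp [X, B, Matrix.mul_apply, Matrix.one_apply, apply_ite (star : ℂ → ℂ), eq_comm]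
    simpa [Matrix.one_apply, eq_comm] using h1.symm
  have h2 := (hψ.map_posSemidef 2 X hX).submatrix
    (Sum.elim (fun i => ((0 : Fin 2), i)) (fun i => ((1 : Fin 2), i)) :
      Fin n ⊕ Fin n → Fin 2 × Fin n)
  convert h2
  ext (i | i) (j | j) <;> simp [X, hψ.map_one]

theorem IsUCP.map_conjTranspose_of_unitary {g d n : ℕ} {z : Fin g → Matrix (Fin d) (Fin d) ℂ}
    {ψ : operatorSystem z →ₗ[ℂ] Matrix (Fin n) (Fin n) ℂ} (hψ : IsUCP z ψ)
    {u : Matrix (Fin d) (Fin d) ℂ} (hu : u ∈ operatorSystem z) (hu' : uᴴ ∈ operatorSystem z)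
    (h : uᴴ * u = 1) : ψ ⟨uᴴ, hu'⟩ = (ψ ⟨u, hu⟩)ᴴ := by
  have := (hψ.posSemidef_fromBlocks hu hu' h).isHermitian
  rw [Matrix.isHermitian_fromBlocks_iff] at this
  exact this.2.1.symm

/-- The Schur complement of the upper left `1` in the positive block matrix is `1 - ψ(u)ᴴ ψ(u)`. -/
theorem IsUCP.contraction_of_unitary {g d n : ℕ} {z : Fin g → Matrix (Fin d) (Fin d) ℂ}
    {ψ : operatorSystem z →ₗ[ℂ] Matrix (Fin n) (Fin n) ℂ} (hψ : IsUCP z ψ)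
    {u : Matrix (Fin d) (Fin d) ℂ} (hu : u ∈ operatorSystem z) (hu' : uᴴ ∈ operatorSystem z)
    (h : uᴴ * u = 1) : (1 - (ψ ⟨u, hu⟩)ᴴ * ψ ⟨u, hu⟩).PosSemidef := by
  have h1 := hψ.posSemidef_fromBlocks hu hu' h
  rw [hψ.map_conjTranspose_of_unitary hu hu' h] at h1
  have : Invertible (1 : Matrix (Fin n) (Fin n) ℂ) := invertibleOne
  rw [Matrix.PosDef.fromBlocks₁₁ _ _ Matrix.PosDef.one] at h1
  simpa using h1

theorem contraction_of_mem_matrixRange {g d n : ℕ} {z : Fin g → Matrix (Fin d) (Fin d) ℂ}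
    {a : Fin g → Matrix (Fin n) (Fin n) ℂ} (ha : a ∈ matrixRange z n) {k : Fin g}
    (h : (z k)ᴴ * z k = 1) :
    (1 - (a k)ᴴ * a k).PosSemidef ∧ (1 - a k * (a k)ᴴ).PosSemidef := by
  obtain ⟨ψ, hψ, hψa⟩ := ha
  have hu := mem_operatorSystem z k
  have hu' := conjTranspose_mem_operatorSystem z k
  have hu'' : (z k)ᴴᴴ ∈ operatorSystem z := by rwa [conjTranspose_conjTranspose]
  rw [hψa]
  refine ⟨hψ.contraction_of_unitary hu hu' h, ?_⟩
  have := hψ.contraction_of_unitary hu' hu''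
    (by rw [conjTranspose_conjTranspose]; exact mul_eq_one_comm.1 h)
  rwa [hψ.map_conjTranspose_of_unitary hu hu' h, conjTranspose_conjTranspose] at this

/-! ### Convex combinations of contractions equal to a unitary -/

/-- If a unitary is a matrix convex combination of contractions, then the coefficients
intertwine. -/
theorem intertwines_of_sum_eq_unitary {n m : ℕ} {N : Fin m → ℕ}
    {a : ∀ j, Matrix (Fin (N j)) (Fin (N j)) ℂ} {γ : ∀ j, Matrix (Fin (N j)) (Fin n) ℂ}
    {b : Matrix (Fin n) (Fin n) ℂ} (hγ : ∑ j, (γ j)ᴴ * γ j = 1)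
    (ha : ∀ j, (1 - (a j)ᴴ * a j).PosSemidef) (hb : bᴴ * b = 1)
    (hab : b = ∑ j, (γ j)ᴴ * a j * γ j) (j : Fin m) : a j * γ j = γ j * b := by
  have hab' : bᴴ = ∑ j, (γ j)ᴴ * (a j)ᴴ * γ j := by
    rw [hab, conjTranspose_sum]
    exact Finset.sum_congr rfl fun j _ => by
      simp [conjTranspose_mul, Matrix.mul_assoc]
  -- Both summands on the left are positive semidefinite. Summed over `j`, the right side becomes `1
  -- - bᴴ * b - bᴴ * b + bᴴ * b = 0`.
  have e (j) : (a j * γ j - γ j * b)ᴴ * (a j * γ j - γ j * b) +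
      (γ j)ᴴ * (1 - (a j)ᴴ * a j) * γ j =
      (γ j)ᴴ * γ j - (γ j)ᴴ * (a j)ᴴ * γ j * b - bᴴ * ((γ j)ᴴ * a j * γ j) +
        bᴴ * ((γ j)ᴴ * γ j) * b := by
    simp only [conjTranspose_sub, conjTranspose_mul, Matrix.mul_sub, Matrix.sub_mul,
      Matrix.mul_assoc, Matrix.mul_one]
    abel
  have hsum : ∑ j, ((a j * γ j - γ j * b)ᴴ * (a j * γ j - γ j * b) +
      (γ j)ᴴ * (1 - (a j)ᴴ * a j) * γ j) = 0 := by
    simp only [e, Finset.sum_add_distrib, Finset.sum_sub_distrib, ← Matrix.mul_sum,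
      ← Matrix.sum_mul, hγ, ← hab, ← hab', hb, Matrix.mul_one]
    abel
  have hp1 (j) := Matrix.posSemidef_conjTranspose_mul_self (a j * γ j - γ j * b)
  have hp2 (j) := (ha j).conjTranspose_mul_mul_same (γ j)
  -- Nonnegative traces adding up to zero all vanish, and `trace (Dᴴ * D) = 0` forces `D = 0`.
  have htr := congrArg Matrix.trace hsum
  rw [Matrix.trace_sum, Matrix.trace_zero, Finset.sum_eq_zero_iff_of_nonneg
    (fun j _ => ((hp1 j).add (hp2 j)).trace_nonneg)] at htr
  have h0 := htr j (Finset.mem_univ j)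
  rw [Matrix.trace_add, add_eq_zero_iff_of_nonneg (hp1 j).trace_nonneg (hp2 j).trace_nonneg] at h0
  exact sub_eq_zero.1 (Matrix.trace_conjTranspose_mul_self_eq_zero_iff.1 h0.1)

/-! ### Completion of isometries -/

theorem le_of_conjTranspose_mul_self_eq_one {n N : ℕ} {V : Matrix (Fin N) (Fin n) ℂ}
    (hV : Vᴴ * V = 1) : n ≤ N := by
  have h1 : (Vᴴ * V).rank ≤ V.rank := Matrix.rank_mul_le_right _ _
  rw [hV, Matrix.rank_one, Fintype.card_fin] at h1
  exact h1.trans (by simpa using V.rank_le_height)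

theorem exists_isometry_completion {n l : ℕ} {V : Matrix (Fin (n + l)) (Fin n) ℂ}
    (hV : Vᴴ * V = 1) :
    ∃ W : Matrix (Fin (n + l)) (Fin l) ℂ,
      (Matrix.fromCols V W)ᴴ * Matrix.fromCols V W = 1 := by
  -- The zeros are placeholders: the extension has to agree with `v` only on the left summand.
  let v : Fin n ⊕ Fin l → EuclideanSpace ℂ (Fin (n + l)) :=
    Sum.elim (fun i => WithLp.toLp 2 (V.col i)) 0
  have hv : Orthonormal ℂ ((Set.range Sum.inl).domRestrict v) := by
    rw [orthonormal_iff_ite]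
    rintro ⟨_, i, rfl⟩ ⟨_, j, rfl⟩
    have h1 := congrFun (congrFun hV i) j
    rw [Matrix.mul_apply] at h1
    by_cases hij : i = j
    · subst hij
      rw [if_pos rfl, PiLp.inner_apply]
      simpa [v, mul_comm, Set.domRestrict_apply, Complex.mul_conj'] using h1
    · rw [if_neg fun h => hij (Sum.inl_injective (congrArg Subtype.val h))]
      simpa [v, PiLp.inner_apply, mul_comm, Set.domRestrict_apply, hij] using h1
  obtain ⟨b, hb⟩ := hv.exists_orthonormalBasis_extension_of_card_eq (by simp)
  refine ⟨Matrix.of fun i k => b (Sum.inr k) i, ?_⟩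
  have hU : Matrix.fromCols V (Matrix.of fun i k => b (Sum.inr k) i) =
      Matrix.of fun i k => b k i := by
    ext i (k | k)
    · simp [hb (Sum.inl k) ⟨k, rfl⟩, v]
    · simp
  rw [hU]
  ext i j
  have h2 := orthonormal_iff_ite.1 b.orthonormal i j
  rw [PiLp.inner_apply] at h2
  simpa [Matrix.mul_apply, Matrix.one_apply, mul_comm] using h2

/-- An isometry intertwining `b` with `a` and `bᴴ` with `aᴴ` exhibits `b` as a direct summand
of `a`. -/
theorem unitarilyEquivalent_tupleSum_of_intertwines {g n l : ℕ}
    {a : Fin g → Matrix (Fin (n + l)) (Fin (n + l)) ℂ} {b : Fin g → Matrix (Fin n) (Fin n) ℂ}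
    {V : Matrix (Fin (n + l)) (Fin n) ℂ} (hV : Vᴴ * V = 1)
    (h : ∀ k, a k * V = V * b k) (h' : ∀ k, Vᴴ * a k = b k * Vᴴ) :
    ∃ c : Fin g → Matrix (Fin l) (Fin l) ℂ, UnitarilyEquivalent a (tupleSum b c) := by
  obtain ⟨W, hW⟩ := exists_isometry_completion hV
  refine ⟨fun k => Wᴴ * a k * W, Matrix.fromCols V W, hW,
    (Matrix.mul_eq_one_comm_of_equiv finSumFinEquiv).1 hW, fun k => ?_⟩
  rw [Matrix.conjTranspose_fromCols_eq_fromRows_conjTranspose, Matrix.fromRows_mul_fromCols,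
    ← Matrix.fromBlocks_one, Matrix.fromBlocks_inj] at hW
  obtain ⟨-, hVW, hWV, -⟩ := hW
  rw [Matrix.conjTranspose_fromCols_eq_fromRows_conjTranspose, Matrix.fromRows_mul,
    Matrix.fromRows_mul_fromCols, tupleSum, h' k, Matrix.mul_assoc (b k) Vᴴ V, hV,
    Matrix.mul_assoc (b k) Vᴴ W, hVW, Matrix.mul_assoc Wᴴ (a k) V, h k, ← Matrix.mul_assoc, hWV]
  simp

/-! ### Irreducible tuples of unitaries -/

/-- A coefficient of a matrix convex combination that equals an irreducible tuple of unitaries is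
a scalar multiple of an isometry that intertwines. -/
theorem exists_isometry_intertwines {g d : ℕ} {z : Fin g → Matrix (Fin d) (Fin d) ℂ}
    (hz : ∀ k, (z k)ᴴ * z k = 1)
    (hirr : ∀ T : Matrix (Fin d) (Fin d) ℂ, (∀ k, T * z k = z k * T) → ∃ t : ℂ, T = t • 1)
    {m : ℕ} {N : Fin m → ℕ} {a : ∀ j, Fin g → Matrix (Fin (N j)) (Fin (N j)) ℂ}
    {γ : ∀ j, Matrix (Fin (N j)) (Fin d) ℂ}
    (h : IsMatrixConvexCombination (matrixRange z) N a γ z) (j : Fin m) (hj : γ j ≠ 0) :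
    ∃ V : Matrix (Fin (N j)) (Fin d) ℂ, Vᴴ * V = 1 ∧ (∀ k, a j k * V = V * z k) ∧
      ∀ k, Vᴴ * a j k = z k * Vᴴ := by
  have h1 (k) : a j k * γ j = γ j * z k :=
    intertwines_of_sum_eq_unitary h.sum_coeff
      (fun j => (contraction_of_mem_matrixRange (h.mem j) (hz k)).1) (hz k) (h.eq_sum k) j
  have h2 (k) : (a j k)ᴴ * γ j = γ j * (z k)ᴴ := by
    refine intertwines_of_sum_eq_unitary (a := fun j => (a j k)ᴴ) h.sum_coeff (fun j => ?_) ?_ ?_ j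
    · simpa using (contraction_of_mem_matrixRange (h.mem j) (hz k)).2
    · simpa using mul_eq_one_comm.1 (hz k)
    · rw [h.eq_sum, conjTranspose_sum]
      exact Finset.sum_congr rfl fun j _ => by simp [conjTranspose_mul, Matrix.mul_assoc]
  have h3 (k) : (γ j)ᴴ * a j k = z k * (γ j)ᴴ := by
    simpa [conjTranspose_mul] using congrArg conjTranspose (h2 k)
  -- Both products with `z k` equal `(γ j)ᴴ * a j k * γ j`.
  obtain ⟨t, ht⟩ := hirr ((γ j)ᴴ * γ j) fun k => by
    rw [Matrix.mul_assoc, ← h1, ← Matrix.mul_assoc, h3, Matrix.mul_assoc]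
  have hne : (γ j)ᴴ * γ j ≠ 0 := fun h0 => hj (Matrix.conjTranspose_mul_self_eq_zero.1 h0)
  have hd : Nonempty (Fin d) := by
    by_contra hd
    rw [not_nonempty_iff] at hd
    exact hne (Subsingleton.elim _ _)
  obtain ⟨i⟩ := hd
  have ht0 : 0 < t := by
    have h5 := (Matrix.posSemidef_conjTranspose_mul_self (γ j)).diag_nonneg (i := i)
    rw [ht] at h5
    refine lt_of_le_of_ne (by simpa using h5) ?_
    rintro rfl
    exact hne (by rw [ht, zero_smul])
  obtain ⟨r, hr, rfl⟩ : ∃ r : ℝ, 0 < r ∧ (r : ℂ) = t := by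
    have := Complex.pos_iff.1 ht0
    exact ⟨t.re, this.1, Complex.ext rfl (by simpa using this.2)⟩
  refine ⟨(((√r)⁻¹ : ℝ) : ℂ) • γ j, ?_, fun k => ?_, fun k => ?_⟩
  · have h6 : (√r)⁻¹ * ((√r)⁻¹ * r) = 1 := by
      have := Real.sqrt_pos.2 hr
      field_simp
      exact (Real.sq_sqrt hr.le).symm
    simp only [conjTranspose_smul, Matrix.smul_mul, Matrix.mul_smul, ht, smul_smul,
      RCLike.star_def, Complex.conj_ofReal]
    rw [← Complex.ofReal_mul, ← Complex.ofReal_mul, h6, Complex.ofReal_one, one_smul]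
  · simp [h1]
  · simp [h3]

/-- An irreducible tuple of unitaries is a matrix extreme point of its matrix range. -/
theorem isMatrixExtremePoint_of_irreducible {g d : ℕ} {z : Fin g → Matrix (Fin d) (Fin d) ℂ}
    (hz : ∀ k, (z k)ᴴ * z k = 1)
    (hirr : ∀ T : Matrix (Fin d) (Fin d) ℂ, (∀ k, T * z k = z k * T) → ∃ t : ℂ, T = t • 1) :
    IsMatrixExtremePoint (matrixRange z) z where
  convex := isMatrixConvex_matrixRange z
  mem := mem_matrixRange_self z
  extreme m N a γ h hsurj j := by
    have hj : γ j ≠ 0 := by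
      intro h0
      -- Here `0 < N j` is essential: a map onto the zero space is surjective and zero.
      obtain ⟨x, hx⟩ := hsurj j (fun _ => 1)
      have := congrFun hx ⟨0, h.pos j⟩
      simp [h0] at this
    obtain ⟨V, hV, hV1, hV2⟩ := exists_isometry_intertwines hz hirr h j hj
    have hle : N j ≤ d := by
      simpa using LinearMap.finrank_le_finrank_of_surjective (f := (γ j).mulVecLin) (hsurj j)
    have hN : N j = d := le_antisymm hle (le_of_conjTranspose_mul_self_eq_one hV)
    refine ⟨hN, V, hV, (Matrix.mul_eq_one_comm_of_equiv (finCongr hN.symm)).1 hV, fun k => ?_⟩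
    rw [Matrix.mul_assoc, hV1, ← Matrix.mul_assoc, hV, Matrix.one_mul]

/-- An irreducible tuple of unitaries is an absolute extreme point of its matrix range. -/
theorem isAbsoluteExtremePoint_of_irreducible {g d : ℕ} {z : Fin g → Matrix (Fin d) (Fin d) ℂ}
    (hz : ∀ k, (z k)ᴴ * z k = 1)
    (hirr : ∀ T : Matrix (Fin d) (Fin d) ℂ, (∀ k, T * z k = z k * T) → ∃ t : ℂ, T = t • 1) :
    IsAbsoluteExtremePoint (matrixRange z) z where
  convex := isMatrixConvex_matrixRange z
  mem := mem_matrixRange_self z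
  extreme m N a γ h hγ j := by
    obtain ⟨V, hV, hV1, hV2⟩ := exists_isometry_intertwines hz hirr h j (hγ j)
    rcases (le_of_conjTranspose_mul_self_eq_one hV).eq_or_lt with hN | hN
    · refine .inl ⟨hN.symm, V, hV, (Matrix.mul_eq_one_comm_of_equiv (finCongr hN)).1 hV,
        fun k => ?_⟩
      rw [Matrix.mul_assoc, hV1, ← Matrix.mul_assoc, hV, Matrix.one_mul]
    · refine .inr ⟨hN, ?_⟩
      -- The type of `a j` depends on `N j`, so `a j` is abstracted before `N j` is replaced by `d +
      -- l`.
      generalize a j = A at hV1 hV2 ⊢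
      revert A V
      obtain ⟨l, hl⟩ := Nat.exists_eq_add_of_le hN.le
      generalize N j = M at hl
      subst hl
      intro V hV A hV1 hV2
      exact ⟨l, unitarilyEquivalent_tupleSum_of_intertwines hV hV1 hV2⟩

/-! ### The Weyl triple -/

theorem conjTranspose_weylU_mul_weylU {p : ℕ} {ζ : ℂ} (hζ : ‖ζ‖ = 1) :
    (weylU p ζ)ᴴ * weylU p ζ = 1 := by
  rw [weylU, diagonal_conjTranspose, diagonal_mul_diagonal, ← diagonal_one]
  congr 1
  ext i
  simp [← mul_pow, Complex.conj_mul', hζ]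

theorem weylV_conjTranspose_mul_weylV {p : ℕ} : (weylV p)ᴴ * weylV p = 1 := by
  ext i j
  have hp : 0 < p := i.pos
  -- Column `i` of the shift has its only nonzero entry in row `i + 1` modulo `p`.
  rw [Matrix.mul_apply, Finset.sum_eq_single ⟨((i : ℕ) + 1) % p, Nat.mod_lt _ hp⟩]
  · have : ((i : ℕ) + 1) % p = ((j : ℕ) + 1) % p ↔ i = j := by
      refine ⟨fun h => Fin.ext ?_, fun h => by rw [h]⟩
      exact Nat.ModEq.eq_of_lt_of_lt (Nat.ModEq.add_right_cancel' 1 h) i.2 j.2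
    simp [weylV, Matrix.one_apply, this]
  · intro k _ hk
    have : (k : ℕ) ≠ ((i : ℕ) + 1) % p := fun h => hk (Fin.ext h)
    simp [weylV, this]
  · simp

theorem weylTriple_conjTranspose_mul_self {p : ℕ} {ζ η : ℂ} (hζ : ‖ζ‖ = 1) (hη : ‖η‖ = 1)
    (k : Fin 3) : (weylTriple p ζ η k)ᴴ * weylTriple p ζ η k = 1 := by
  have hu := conjTranspose_weylU_mul_weylU (p := p) hζ
  have hv := weylV_conjTranspose_mul_weylV (p := p)
  fin_cases k
  · simpa [weylTriple] using hu
  · have h1 : (η ^ (p - 1)) * (star η ^ (p - 1)) = 1 := by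
      simp [← mul_pow, Complex.mul_conj', hη]
    simp only [weylTriple, Fin.mk_one, Matrix.cons_val_one, Matrix.cons_val_zero,
      conjTranspose_smul, conjTranspose_mul, Matrix.smul_mul, Matrix.mul_smul, smul_smul, star_pow,
      h1, one_smul]
    rw [Matrix.mul_assoc, ← Matrix.mul_assoc _ (weylU p ζ), hu, Matrix.one_mul, hv]
  · simpa [weylTriple] using hv

/-- The Weyl matrices are irreducible: only scalars commute with both. -/
theorem eq_smul_one_of_commute_weyl {p : ℕ} {ζ : ℂ} (hζ : IsPrimitiveRoot ζ p)
    {T : Matrix (Fin p) (Fin p) ℂ} (hU : T * weylU p ζ = weylU p ζ * T)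
    (hV : T * weylV p = weylV p * T) : ∃ t : ℂ, T = t • 1 := by
  -- Entrywise, `T i j * ζ ^ j = ζ ^ i * T i j`, and the powers of `ζ` below `p` are distinct.
  have hoff (i j : Fin p) (hij : i ≠ j) : T i j = 0 := by
    have h := congrFun (congrFun hU i) j
    rw [weylU, Matrix.mul_diagonal, Matrix.diagonal_mul] at h
    by_contra h0
    refine hij (Fin.ext (hζ.pow_inj i.2 j.2 ?_))
    rw [mul_comm] at h
    exact (mul_right_cancel₀ h0 h).symm
  -- The `(k + 1, k)` entries of `T 𝔳 = 𝔳 T` carry diagonal equality one step; the wrap-around is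
  -- not needed.
  have hstep (k : ℕ) (hk : k + 1 < p) :
      T ⟨k + 1, hk⟩ ⟨k + 1, hk⟩ = T ⟨k, by omega⟩ ⟨k, by omega⟩ := by
    have h := congrFun (congrFun hV ⟨k + 1, hk⟩) ⟨k, by omega⟩
    rw [Matrix.mul_apply, Matrix.mul_apply, Finset.sum_eq_single ⟨k + 1, hk⟩,
      Finset.sum_eq_single ⟨k, by omega⟩] at h
    · simpa [weylV, Nat.mod_eq_of_lt hk] using h
    · intro i _ hi
      rw [hoff _ _ hi, mul_zero]
    · simp
    · intro i _ hi
      rw [hoff _ _ hi.symm, zero_mul]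
    · simp
  rcases Nat.eq_zero_or_pos p with rfl | hp
  · exact ⟨0, Subsingleton.elim _ _⟩
  have hdiag (k : ℕ) : ∀ hk : k < p, T ⟨k, hk⟩ ⟨k, hk⟩ = T ⟨0, hp⟩ ⟨0, hp⟩ := by
    induction k with
    | zero => intro _; rfl
    | succ k ih => intro hk; rw [hstep k hk, ih]
  refine ⟨T ⟨0, hp⟩ ⟨0, hp⟩, ?_⟩
  ext i j
  by_cases hij : i = j
  · subst hij
    simpa using hdiag i i.2
  · simp [hoff i j hij, hij]

end WeylBrauer

theorem mainTheorem9 (p : ℕ) (hp : 2 ≤ p) (ζ η : ℂ) (hζ : IsPrimitiveRoot ζ p)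
    (hη : η ^ 2 = ζ) :
    WeylBrauer.IsMatrixExtremePoint (WeylBrauer.matrixRange (WeylBrauer.weylTriple p ζ η))
        (WeylBrauer.weylTriple p ζ η) ∧
      WeylBrauer.IsAbsoluteExtremePoint (WeylBrauer.matrixRange (WeylBrauer.weylTriple p ζ η))
        (WeylBrauer.weylTriple p ζ η) := by
  have hζ1 : ‖ζ‖ = 1 := hζ.norm'_eq_one (by omega)
  have hη1 : ‖η‖ = 1 := by
    rw [← hη, norm_pow] at hζ1
    exact (pow_eq_one_iff_of_nonneg (norm_nonneg η) two_ne_zero).1 hζ1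
  have hz := WeylBrauer.weylTriple_conjTranspose_mul_self (p := p) hζ1 hη1
  have hirr (T : Matrix (Fin p) (Fin p) ℂ)
      (hT : ∀ k, T * WeylBrauer.weylTriple p ζ η k = WeylBrauer.weylTriple p ζ η k * T) :
      ∃ t : ℂ, T = t • 1 :=
    -- Indices `0` and `2` are `𝔲` and `𝔳`, which are already irreducible together.
    WeylBrauer.eq_smul_one_of_commute_weyl hζ (hT 0) (hT 2)
  exact ⟨WeylBrauer.isMatrixExtremePoint_of_irreducible hz hirr,
    WeylBrauer.isAbsoluteExtremePoint_of_irreducible hz hirr⟩
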